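/- A state of $n$ qubits is a unit vector of $(\mathbb C^2)^{\otimes n}$. Such a vector can be described by a rooted tree whose inner vertices are $+$ and $\otimes$ gates and whose leaves each carry a (not necessarily normalized) vector $\alpha|0\rangle+\beta|1\rangle$ of one of the qubits; every vertex lives on a set of qubits, the children of a $+$ gate live on the same set as the gate and their vectors are added, the children of a $\otimes$ gate live on pairwise disjoint sets whose union is that of the gate and their vectors are tensored, and the root lives on all $n$ qubits. The size of a tree is its number of leaves, the tree size $\mathrm{TS}(|\varphi\rangle)$ is the minimum size of a tree describing $|\varphi\rangle$, and the $\epsilon$-approximate tree size $\mathrm{TS}_\epsilon(|\Psi\rangle)$ is the minimum of $\mathrm{TS}(|\varphi\rangle)$ over all states $|\varphi\rangle$ with $|\langle\Psi|\varphi\rangle|^2\ge 1-\epsilon$. Let $$|\Psi^{(4)}\rangle=\sqrt{\tfrac13}\Big[\tfrac12\big(|0110\rangle+|0101\rangle+|1001\rangle+|1010\rangle\big)-|0011\rangle-|1100\rangle\Big].$$ Then $\mathrm{TS}_\epsilon(|\Psi^{(4)}\rangle)=14$ for every $0<\epsilon<\frac1{12}$. Moreover, every four-qubit state $|\varphi\rangle$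 described by a tree with at most $13$ leaves satisfies $|\langle\Psi^{(4)}|\varphi\rangle|^2\le\frac{11}{12}$. -/

import Mathlib

/-- The Hilbert space of `n` qubits. Its standard basis is indexed by the bit strings
`Fin n → Fin 2`; the `i`-th bit belongs to the `i`-th qubit. -/
abbrev QubitSpace (n : ℕ) : Type := EuclideanSpace ℂ (Fin n → Fin 2)

/-- The computational basis vector `|x₁ x₂ … xₙ⟩`. -/
noncomputable def ket {n : ℕ} (x : Fin n → Fin 2) : QubitSpace n :=
  EuclideanSpace.single x (1 : ℂ)

/-- A rooted tree of `+` and `⊗` gates of arbitrary (positive) fan-in, together with the set `S`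
of qubits on which it lives. A leaf carries a qubit `i` and a vector `v 0 |0⟩ + v 1 |1⟩` of that
qubit, not necessarily normalized. All children of a `+` gate live on the same set of qubits; the
children of a `⊗` gate live on pairwise disjoint sets whose union is the set of the gate. -/
inductive StateTree {n : ℕ} : Finset (Fin n) → Type
  | leaf (i : Fin n) (v : Fin 2 → ℂ) : StateTree {i}
  | plus {S : Finset (Fin n)} (k : ℕ) (c : Fin (k + 1) → StateTree S) : StateTree S
  | tensor {S : Finset (Fin n)} (k : ℕ) (P : Fin (k + 1) → Finset (Fin n))
      (disj : ∀ a b, a ≠ b → Disjoint (P a) (P b)) (cover : Finset.univ.biUnion P = S)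
      (c : (j : Fin (k + 1)) → StateTree (P j)) : StateTree S

namespace StateTree

/-- The size of a tree: its number of leaves. -/
def size {n : ℕ} : {S : Finset (Fin n)} → StateTree S → ℕ
  | _, leaf _ _ => 1
  | _, plus _ c => ∑ j, (c j).size
  | _, tensor _ _ _ _ c => ∑ j, (c j).size

/-- The amplitudes of the vector computed by a tree on the qubits in `S`: the coefficient of the
basis vector of these qubits that is given by the bits `x i`, `i ∈ S` (the other bits of `x` are
not read). Vectors are added at a `+` gate; at a `⊗` gate the tensor product is taken, whose
amplitudes are the products of the amplitudes of the factors. -/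
noncomputable def amp {n : ℕ} :
    {S : Finset (Fin n)} → StateTree S → (Fin n → Fin 2) → ℂ
  | _, leaf i v, x => v (x i)
  | _, plus _ c, x => ∑ j, (c j).amp x
  | _, tensor _ _ _ _ c, x => ∏ j, (c j).amp x

/-- The tree `T` on all `n` qubits describes the vector `φ`. -/
def Describes {n : ℕ} (T : StateTree (Finset.univ : Finset (Fin n))) (φ : QubitSpace n) : Prop :=
  ∀ x, φ x = T.amp x

end StateTree

/-- The tree size of `φ`: the least number of leaves of a tree that describes `φ`
(`⊤` if there were no such tree). -/
noncomputable def treeSize {n : ℕ} (φ : QubitSpace n) : ℕ∞ :=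
  ⨅ (T : StateTree (Finset.univ : Finset (Fin n))) (_ : T.Describes φ), (T.size : ℕ∞)

/-- The `ε`-approximate tree size of `ψ`: the least tree size of a normalized state `φ` with
`|⟨ψ|φ⟩|² ≥ 1 - ε`. -/
noncomputable def approxTreeSize {n : ℕ} (ε : ℝ) (ψ : QubitSpace n) : ℕ∞ :=
  ⨅ (φ : QubitSpace n) (_ : ‖φ‖ = 1) (_ : 1 - ε ≤ ‖inner ℂ ψ φ‖ ^ 2), treeSize φ

/-- The four-qubit state `|Ψ⁽⁴⁾⟩`. -/
noncomputable def Psi4 : QubitSpace 4 :=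
  ((Real.sqrt (1 / 3) : ℝ) : ℂ) •
    ((1 / 2 : ℂ) • (ket ![0, 1, 1, 0] + ket ![0, 1, 0, 1] + ket ![1, 0, 0, 1] + ket ![1, 0, 1, 0])
      - ket ![0, 0, 1, 1] - ket ![1, 1, 0, 0])

/-! Every vector computed with at most 13 leaves is killed by contraction with some nonzero `u` on
two qubits (`TreeRep.hasVanishingContraction`), while `Psi4` keeps a definite distance from all such
vectors (`norm_inner_sq_le`).

Combinatorics: a tree needs a leaf for each of its qubits, so a binary `+` gate on `s` qubits costs
at least `2 * s` leaves. A root `+` with 13 leaves thus has summands of sizes (≤ 5, ≤ 9) or (≤ 6, ≤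
7), up to order, and such small summands must factor. Three terms that factor across a pair impose
three linear conditions on the four entries of `u`; in the other patterns a product `u` can be
chosen.

Analysis: across a pair other than {0, 1} and {2, 3}, the smallest singular value of `√3 • Psi4` is
1/2. Across those two the singlet is in the kernel, so `u` must be a product there; the bound 1/2
then holds again. Cauchy–Schwarz turns this into a squared distance of at least (1/3)(1/4) = 1/12
from the line of `φ`.

For the upper bound, fixing the first qubit leaves a three-qubit tangent vector to the product
states, a limit of differences of two products; this costs 2(1 + 3 + 3) = 14 leaves. -/

/-- `TreeRep m S f`: the function `f` on bit strings is the amplitude function of a tree of binary `+`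
and `⊗` gates on the qubits in `S` with `m` leaves. -/
inductive TreeRep {n : ℕ} : ℕ → Finset (Fin n) → ((Fin n → Fin 2) → ℂ) → Prop
  | leaf (i : Fin n) (v : Fin 2 → ℂ) : TreeRep 1 {i} (fun x => v (x i))
  | add {k l : ℕ} {S : Finset (Fin n)} {f g : (Fin n → Fin 2) → ℂ} :
      TreeRep k S f → TreeRep l S g → TreeRep (k + l) S (f + g)
  | mul {k l : ℕ} {A B : Finset (Fin n)} {f g : (Fin n → Fin 2) → ℂ} :
      Disjoint A B → TreeRep k A f → TreeRep l B g → TreeRep (k + l) (A ∪ B) (f * g)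

namespace TreeRep

variable {n : ℕ}

theorem sum {S : Finset (Fin n)} (k : ℕ) (m : Fin (k + 1) → ℕ)
    (f : Fin (k + 1) → (Fin n → Fin 2) → ℂ) (h : ∀ j, TreeRep (m j) S (f j)) :
    TreeRep (∑ j, m j) S (∑ j, f j) := by
  induction k with
  | zero => simpa using h 0
  | succ k ih =>
    rw [Fin.sum_univ_succ, Fin.sum_univ_succ f]
    exact (h 0).add (ih _ _ fun j => h j.succ)

theorem prod (k : ℕ) (P : Fin (k + 1) → Finset (Fin n)) (m : Fin (k + 1) → ℕ)
    (f : Fin (k + 1) → (Fin n → Fin 2) → ℂ) (disj : ∀ a b, a ≠ b → Disjoint (P a) (P b))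
    (h : ∀ j, TreeRep (m j) (P j) (f j)) :
    TreeRep (∑ j, m j) (Finset.univ.biUnion P) (∏ j, f j) := by
  induction k with
  | zero => simpa using h 0
  | succ k ih =>
    have hU : Finset.univ.biUnion P = P 0 ∪ Finset.univ.biUnion fun j : Fin (k + 1) => P j.succ := by
      ext x
      simp [Fin.exists_fin_succ]
    rw [Fin.sum_univ_succ, Fin.prod_univ_succ f, hU]
    refine (h 0).mul ?_ (ih _ _ _ (fun a b hab => disj _ _ (by simpa using hab)) fun j => h j.succ)
    rw [Finset.disjoint_biUnion_right]
    exact fun j _ => disj _ _ (Fin.succ_ne_zero j).symm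

theorem of_tree {S : Finset (Fin n)} (T : StateTree S) : TreeRep T.size S T.amp := by
  induction T with
  | leaf i v => exact TreeRep.leaf i v
  | plus k c ih =>
    have e : (StateTree.plus k c).amp = ∑ j, (c j).amp := by
      ext x
      simp [StateTree.amp]
    rw [e]
    exact TreeRep.sum k _ _ ih
  | tensor k P disj cover c ih =>
    subst cover
    have e : (StateTree.tensor k P disj rfl c).amp = ∏ j, (c j).amp := by
      ext x
      simp [StateTree.amp]
    rw [e]
    exact TreeRep.prod k P _ _ disj ih

theorem exists_tree {m : ℕ} {S : Finset (Fin n)} {f : (Fin n → Fin 2) → ℂ} (h : TreeRep m S f) :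
    ∃ T : StateTree S, T.size = m ∧ T.amp = f := by
  induction h with
  | leaf i v => exact ⟨.leaf i v, rfl, rfl⟩
  | add _ _ ih₁ ih₂ =>
    obtain ⟨T₁, h₁, a₁⟩ := ih₁
    obtain ⟨T₂, h₂, a₂⟩ := ih₂
    refine ⟨.plus 1 ![T₁, T₂], ?_, ?_⟩
    · simp [StateTree.size, h₁, h₂]
    · ext x
      simp [StateTree.amp, a₁, a₂]
  | @mul k l A B f g hd _ _ ih₁ ih₂ =>
    obtain ⟨T₁, h₁, a₁⟩ := ih₁
    obtain ⟨T₂, h₂, a₂⟩ := ih₂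
    refine ⟨.tensor 1 ![A, B] ?_ ?_ (Fin.cons T₁ (Fin.cons T₂ finZeroElim)), ?_, ?_⟩
    · intro a b hab
      fin_cases a <;> fin_cases b <;> simp_all [disjoint_comm]
    · ext x
      simp [Fin.exists_fin_two]
    · rw [StateTree.size, Fin.sum_univ_two, ← h₁, ← h₂]
      rfl
    · ext x
      rw [StateTree.amp, Fin.prod_univ_two, ← a₁, ← a₂]
      rfl

theorem smul {m : ℕ} {S : Finset (Fin n)} {f : (Fin n → Fin 2) → ℂ} (r : ℂ) (h : TreeRep m S f) :
    TreeRep m S (r • f) := by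
  induction h with
  | leaf i v => exact TreeRep.leaf i (r • v)
  | add _ _ ih₁ ih₂ =>
    rw [smul_add]
    exact ih₁.add ih₂
  | mul hd _ h₂ ih₁ _ =>
    rw [← smul_mul_assoc]
    exact ih₁.mul hd h₂

theorem nonempty {m : ℕ} {S : Finset (Fin n)} {f : (Fin n → Fin 2) → ℂ} (h : TreeRep m S f) :
    S.Nonempty := by
  induction h with
  | leaf i v => simp
  | add _ _ ih _ => exact ih
  | mul _ _ _ ih _ => exact ih.mono Finset.subset_union_left

theorem card_le {m : ℕ} {S : Finset (Fin n)} {f : (Fin n → Fin 2) → ℂ} (h : TreeRep m S f) :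
    S.card ≤ m := by
  induction h with
  | leaf i v => simp
  | add _ _ _ _ => omega
  | mul hd _ _ _ _ =>
    rw [Finset.card_union_of_disjoint hd]
    omega

theorem dependsOn {m : ℕ} {S : Finset (Fin n)} {f : (Fin n → Fin 2) → ℂ} (h : TreeRep m S f) :
    DependsOn f (S : Set (Fin n)) := by
  induction h with
  | leaf i v =>
    intro x y hxy
    simp only
    rw [hxy i (by simp)]
  | add _ _ ih₁ ih₂ =>
    intro x y hxy
    simp only [Pi.add_apply, ih₁ hxy, ih₂ hxy]
  | mul _ _ _ ih₁ ih₂ =>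
    intro x y hxy
    simp only [Pi.mul_apply]
    rw [ih₁ fun i hi => hxy i (by simp_all), ih₂ fun i hi => hxy i (by simp_all)]

end TreeRep

/-! ### Factorization of small trees -/

/-- The product functions of the bits in `S`. -/
def IsProd {n : ℕ} (S : Finset (Fin n)) (f : (Fin n → Fin 2) → ℂ) : Prop :=
  ∃ v : Fin n → Fin 2 → ℂ, f = fun x => ∏ i ∈ S, v i (x i)

section Prod

variable {n : ℕ}

theorem exists_of_dependsOn_singleton {i : Fin n} {f : (Fin n → Fin 2) → ℂ}
    (h : DependsOn f (({i} : Finset (Fin n)) : Set (Fin n))) :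
    ∃ a : Fin 2 → ℂ, f = fun x => a (x i) := by
  refine ⟨fun s => f fun _ => s, ?_⟩
  ext x
  exact h (by simp)

theorem exists_of_dependsOn_pair {i j : Fin n} (hij : i ≠ j) {f : (Fin n → Fin 2) → ℂ}
    (h : DependsOn f (({i, j} : Finset (Fin n)) : Set (Fin n))) :
    ∃ g : Fin 2 → Fin 2 → ℂ, f = fun x => g (x i) (x j) := by
  refine ⟨fun s t => f (Function.update (fun _ => s) j t), ?_⟩
  ext x
  refine h ?_
  simp [hij]

theorem isProd_singleton {i : Fin n} (a : Fin 2 → ℂ) : IsProd {i} fun x => a (x i) :=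
  ⟨fun _ => a, by simp⟩

theorem IsProd.mul {A B : Finset (Fin n)} (hd : Disjoint A B) {f g : (Fin n → Fin 2) → ℂ}
    (hf : IsProd A f) (hg : IsProd B g) : IsProd (A ∪ B) (f * g) := by
  obtain ⟨v, rfl⟩ := hf
  obtain ⟨w, rfl⟩ := hg
  refine ⟨fun i => if i ∈ A then v i else w i, ?_⟩
  ext x
  rw [Finset.prod_union hd]
  simp only [Pi.mul_apply]
  congr 1
  · exact Finset.prod_congr rfl fun i hi => by simp [hi]
  · exact Finset.prod_congr rfl fun i hi => by simp [Finset.disjoint_right.mp hd hi]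

/-- A `+` gate needs `2 * S.card` leaves, which fits in `S.card + 1` only on a single qubit, where
every function is a product. -/
theorem TreeRep.isProd {m : ℕ} {S : Finset (Fin n)} {f : (Fin n → Fin 2) → ℂ} (h : TreeRep m S f)
    (hm : m ≤ S.card + 1) : IsProd S f := by
  induction h with
  | leaf i v => exact isProd_singleton v
  | @add k l S f g h₁ h₂ _ _ =>
    have c₁ := h₁.card_le
    have c₂ := h₂.card_le
    obtain ⟨i, rfl⟩ := Finset.card_eq_one.mp
      (by have := Finset.card_pos.mpr h₁.nonempty; omega : S.card = 1)
    obtain ⟨a, ha⟩ := exists_of_dependsOn_singleton (h₁.add h₂).dependsOn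
    rw [ha]
    exact isProd_singleton a
  | mul hd h₁ h₂ ih₁ ih₂ =>
    rw [Finset.card_union_of_disjoint hd] at hm
    have c₁ := h₁.card_le
    have c₂ := h₂.card_le
    exact (ih₁ (by omega)).mul hd (ih₂ (by omega))

/-- The sums of two product functions of the bits in `S`. -/
def IsProdAddProd {n : ℕ} (S : Finset (Fin n)) (f : (Fin n → Fin 2) → ℂ) : Prop :=
  ∃ g h, IsProd S g ∧ IsProd S h ∧ f = g + h

/-- Expand in the computational basis of one of the two qubits. -/
theorem isProdAddProd_of_card_eq_two {S : Finset (Fin n)} (hS : S.card = 2)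
    {f : (Fin n → Fin 2) → ℂ} (h : DependsOn f (S : Set (Fin n))) : IsProdAddProd S f := by
  obtain ⟨i, j, hij, rfl⟩ := Finset.card_eq_two.mp hS
  obtain ⟨g, rfl⟩ := exists_of_dependsOn_pair hij h
  have hd : Disjoint ({i} : Finset (Fin n)) {j} := by simpa using hij
  refine ⟨_, _,
    (isProd_singleton (i := i) fun s => if s = 0 then 1 else 0).mul hd
      (isProd_singleton (i := j) (g 0)),
    (isProd_singleton (i := i) fun s => if s = 0 then 0 else 1).mul hd
      (isProd_singleton (i := j) (g 1)), ?_⟩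
  ext x
  simp only [Pi.add_apply, Pi.mul_apply]
  generalize x i = s
  fin_cases s <;> simp

theorem IsProd.mul_isProdAddProd {A B : Finset (Fin n)} (hd : Disjoint A B)
    {f g : (Fin n → Fin 2) → ℂ} (hf : IsProd A f) (hg : IsProdAddProd B g) :
    IsProdAddProd (A ∪ B) (f * g) := by
  obtain ⟨p, q, hp, hq, rfl⟩ := hg
  exact ⟨_, _, hf.mul hd hp, hf.mul hd hq, mul_add _ _ _⟩

theorem TreeRep.isProd_of_card_eq_one {m : ℕ} {S : Finset (Fin n)} {f : (Fin n → Fin 2) → ℂ}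
    (h : TreeRep m S f) (hS : S.card = 1) : IsProd S f := by
  obtain ⟨i, rfl⟩ := Finset.card_eq_one.mp hS
  obtain ⟨a, rfl⟩ := exists_of_dependsOn_singleton h.dependsOn
  exact isProd_singleton a

/-- At a root `+` both summands have at least 3, hence at most 4, leaves and are products. A root
`⊗` splits the qubits as 1 + 2, and a two-qubit function is a sum of two products. -/
theorem TreeRep.isProdAddProd {m : ℕ} {S : Finset (Fin n)} {f : (Fin n → Fin 2) → ℂ} (h : TreeRep m S f)
    (hS : S.card = 3) (hm : m ≤ 7) : IsProdAddProd S f := by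
  cases h with
  | leaf i v => simp at hS
  | add h₁ h₂ =>
    have c₁ := h₁.card_le
    have c₂ := h₂.card_le
    exact ⟨_, _, h₁.isProd (by omega), h₂.isProd (by omega), rfl⟩
  | @mul k l A B f g hd h₁ h₂ =>
    rw [Finset.card_union_of_disjoint hd] at hS
    have c₁ := Finset.card_pos.mpr h₁.nonempty
    have c₂ := Finset.card_pos.mpr h₂.nonempty
    obtain hA | hB : A.card = 1 ∨ B.card = 1 := by omega
    · exact (h₁.isProd_of_card_eq_one hA).mul_isProdAddProd hd
        (isProdAddProd_of_card_eq_two (by omega) h₂.dependsOn)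
    · rw [mul_comm, Finset.union_comm]
      exact (h₂.isProd_of_card_eq_one hB).mul_isProdAddProd hd.symm
        (isProdAddProd_of_card_eq_two (by omega) h₁.dependsOn)

/-- A three-qubit tree with at most five leaves splits off one qubit. -/
theorem TreeRep.exists_eq_mul {m : ℕ} {S : Finset (Fin n)} {f : (Fin n → Fin 2) → ℂ} (h : TreeRep m S f)
    (hS : S.card = 3) (hm : m ≤ 5) :
    ∃ i ∈ S, ∃ (a : Fin 2 → ℂ) (g : (Fin n → Fin 2) → ℂ),
      DependsOn g ((S.erase i : Finset (Fin n)) : Set (Fin n)) ∧ f = fun x => a (x i) * g x := by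
  have key : ∀ (i : Fin n) (B : Finset (Fin n)) (f g : (Fin n → Fin 2) → ℂ), Disjoint {i} B →
      DependsOn f (({i} : Finset (Fin n)) : Set (Fin n)) → DependsOn g (B : Set (Fin n)) →
      ∃ j ∈ {i} ∪ B, ∃ (a : Fin 2 → ℂ) (h : (Fin n → Fin 2) → ℂ),
        DependsOn h ((({i} ∪ B).erase j : Finset (Fin n)) : Set (Fin n)) ∧
          f * g = fun x => a (x j) * h x := by
    intro i B f g hd hf hg
    obtain ⟨a, rfl⟩ := exists_of_dependsOn_singleton hf
    refine ⟨i, by simp, a, g, ?_, rfl⟩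
    rw [Finset.disjoint_singleton_left] at hd
    rwa [← Finset.insert_eq, Finset.erase_insert hd]
  cases h with
  | leaf i v => simp at hS
  | add h₁ h₂ =>
    have c₁ := h₁.card_le
    have c₂ := h₂.card_le
    omega
  | @mul k l A B f g hd h₁ h₂ =>
    rw [Finset.card_union_of_disjoint hd] at hS
    have c₁ := Finset.card_pos.mpr h₁.nonempty
    have c₂ := Finset.card_pos.mpr h₂.nonempty
    obtain hA | hB : A.card = 1 ∨ B.card = 1 := by omega
    · obtain ⟨i, rfl⟩ := Finset.card_eq_one.mp hA
      exact key i B f g hd h₁.dependsOn h₂.dependsOn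
    · obtain ⟨i, rfl⟩ := Finset.card_eq_one.mp hB
      rw [mul_comm, Finset.union_comm]
      exact key i A g f hd.symm h₂.dependsOn h₁.dependsOn

end Prod

/-! ### Contractions and their kernels -/

/-- The contraction of `f` with `u` on the qubits `i` and `j`. -/
noncomputable def contract {n : ℕ} (i j : Fin n) (u : Fin 2 → Fin 2 → ℂ)
    (f : (Fin n → Fin 2) → ℂ) (x : Fin n → Fin 2) : ℂ :=
  ∑ s, ∑ t, u s t * f (Function.update (Function.update x i s) j t)

section Contract

variable {n : ℕ} {i j : Fin n}

theorem contract_add (u : Fin 2 → Fin 2 → ℂ) (f g : (Fin n → Fin 2) → ℂ) :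
    contract i j u (f + g) = contract i j u f + contract i j u g := by
  ext x
  simp only [contract, Pi.add_apply, mul_add, Finset.sum_add_distrib]

theorem contract_mul (hij : i ≠ j) (u g : Fin 2 → Fin 2 → ℂ) {h : (Fin n → Fin 2) → ℂ}
    (hh : DependsOn h ({i, j}ᶜ : Set (Fin n))) (x : Fin n → Fin 2) :
    contract i j u (fun x => g (x i) (x j) * h x) x = (∑ s, ∑ t, u s t * g s t) * h x := by
  simp only [contract, Finset.sum_mul]
  refine Finset.sum_congr rfl fun s _ => Finset.sum_congr rfl fun t _ => ?_
  have : h (Function.update (Function.update x i s) j t) = h x := by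
    refine hh fun k hk => ?_
    simp only [Set.mem_compl_iff, Set.mem_insert_iff, Set.mem_singleton_iff, not_or] at hk
    simp [hk.1, hk.2]
  simp [this, hij, mul_assoc]

theorem contract_eq_zero_left (hij : i ≠ j) {p a : Fin 2 → ℂ} (hp : ∑ s, p s * a s = 0)
    (q : Fin 2 → ℂ) {h : (Fin n → Fin 2) → ℂ} (hh : DependsOn h ({i}ᶜ : Set (Fin n))) :
    contract i j (fun s t => p s * q t) (fun x => a (x i) * h x) = 0 := by
  ext x
  have e : ∀ s t, h (Function.update (Function.update x i s) j t) = h (Function.update x j t) := by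
    intro s t
    refine hh fun k hk => ?_
    rw [Function.update_comm hij]
    exact Function.update_of_ne (by simpa using hk) _ _
  rw [contract, Finset.sum_comm]
  refine Finset.sum_eq_zero fun t _ => ?_
  simp only [e]
  calc _ = (∑ s, p s * a s) * (q t * h (Function.update x j t)) := by
        rw [Finset.sum_mul]
        refine Finset.sum_congr rfl fun s _ => ?_
        rw [Function.update_of_ne hij, Function.update_self]
        ring
    _ = 0 := by rw [hp, zero_mul]

theorem contract_eq_zero_right (hij : i ≠ j) {q b : Fin 2 → ℂ} (hq : ∑ t, q t * b t = 0)
    (p : Fin 2 → ℂ) {h : (Fin n → Fin 2) → ℂ} (hh : DependsOn h ({j}ᶜ : Set (Fin n))) :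
    contract i j (fun s t => p s * q t) (fun x => b (x j) * h x) = 0 := by
  have := contract_eq_zero_left hij.symm hq p hh
  rw [← this]
  ext x
  rw [contract, contract, Finset.sum_comm]
  refine Finset.sum_congr rfl fun t _ => Finset.sum_congr rfl fun s _ => ?_
  rw [Function.update_comm hij, mul_comm (p s)]

theorem IsProd.exists_single {f : (Fin n → Fin 2) → ℂ} (hf : IsProd Finset.univ f) (i : Fin n) :
    ∃ (a : Fin 2 → ℂ) (h : (Fin n → Fin 2) → ℂ), DependsOn h ({i}ᶜ : Set (Fin n)) ∧
      f = fun x => a (x i) * h x := by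
  obtain ⟨v, rfl⟩ := hf
  refine ⟨v i, fun x => ∏ k ∈ Finset.univ.erase i, v k (x k), ?_, ?_⟩
  · intro x y hxy
    refine Finset.prod_congr rfl fun k hk => ?_
    rw [hxy k (by simpa using hk)]
  · ext x
    exact (Finset.mul_prod_erase _ (fun k => v k (x k)) (Finset.mem_univ i)).symm

theorem IsProd.exists_pair {f : (Fin n → Fin 2) → ℂ} (hf : IsProd Finset.univ f) (hij : i ≠ j) :
    ∃ (g : Fin 2 → Fin 2 → ℂ) (h : (Fin n → Fin 2) → ℂ), DependsOn h ({i, j}ᶜ : Set (Fin n)) ∧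
      f = fun x => g (x i) (x j) * h x := by
  obtain ⟨v, rfl⟩ := hf
  refine ⟨fun s t => v i s * v j t, fun x => ∏ k ∈ (Finset.univ.erase i).erase j, v k (x k), ?_, ?_⟩
  · intro x y hxy
    refine Finset.prod_congr rfl fun k hk => ?_
    simp only [Finset.mem_erase] at hk
    rw [hxy k (by simp [hk.1, hk.2.1])]
  · ext x
    rw [← Finset.mul_prod_erase _ (fun k => v k (x k)) (Finset.mem_univ i),
      ← Finset.mul_prod_erase _ (fun k => v k (x k)) (by simp [hij.symm] : j ∈ Finset.univ.erase i),
      mul_assoc]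

end Contract

theorem exists_ne_zero_sum_eq_zero (a : Fin 2 → ℂ) : ∃ p : Fin 2 → ℂ, p ≠ 0 ∧ ∑ s, p s * a s = 0 := by
  by_cases ha : a = 0
  · exact ⟨1, one_ne_zero, by simp [ha]⟩
  · refine ⟨![a 1, -a 0], fun h => ha ?_, by simp [Fin.sum_univ_two]; ring⟩
    have h0 := congrFun h 0
    have h1 := congrFun h 1
    ext s
    fin_cases s <;> simp_all

/-- Three linear equations in four unknowns. -/
theorem exists_ne_zero_three (g : Fin 3 → Fin 2 → Fin 2 → ℂ) :
    ∃ u : Fin 2 → Fin 2 → ℂ, u ≠ 0 ∧ ∀ k, ∑ s, ∑ t, u s t * g k s t = 0 := by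
  let F : (Fin 2 → Fin 2 → ℂ) →ₗ[ℂ] (Fin 3 → ℂ) :=
    { toFun := fun u k => ∑ s, ∑ t, u s t * g k s t
      map_add' := fun u v => by
        ext k
        simp only [Pi.add_apply, add_mul, Finset.sum_add_distrib]
      map_smul' := fun r u => by
        ext k
        simp only [Pi.smul_apply, smul_eq_mul, Finset.mul_sum, mul_assoc, RingHom.id_apply] }
  have hF : LinearMap.ker F ≠ ⊥ := by
    apply LinearMap.ker_ne_bot_of_finrank_lt
    simp [Module.finrank_pi_fintype]
  obtain ⟨u, hu, hu0⟩ := (Submodule.ne_bot_iff _).mp hF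
  exact ⟨u, hu0, fun k => congrFun (LinearMap.mem_ker.mp hu) k⟩

theorem prod_ne_zero {p q : Fin 2 → ℂ} (hp : p ≠ 0) (hq : q ≠ 0) :
    (fun s t => p s * q t) ≠ 0 := by
  obtain ⟨s, hs⟩ := Function.ne_iff.mp hp
  obtain ⟨t, ht⟩ := Function.ne_iff.mp hq
  exact fun h => mul_ne_zero hs ht (congrFun (congrFun h s) t)

/-! ### Sums with a vanishing contraction -/

/-- The other qubit of the pair `{0, 1}` or `{2, 3}` that contains a qubit. -/
def partner : Fin 4 → Fin 4 := ![1, 0, 3, 2]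

theorem ne_partner (i : Fin 4) : i ≠ partner i := by
  revert i
  decide

theorem pair_compl {i m : Fin 4} (h₁ : m ≠ i) (h₂ : m ≠ partner i) :
    ∀ l, (l = m ∨ l = partner m) ↔ ¬(l = i ∨ l = partner i) := by
  revert i m
  decide

/-- The contraction of `f` on some pair of qubits vanishes; if the pair is `{0, 1}` or `{2, 3}`, then
this holds for a product vector. -/
def HasVanishingContraction (f : (Fin 4 → Fin 2) → ℂ) : Prop :=
  ∃ (i j : Fin 4) (u : Fin 2 → Fin 2 → ℂ), i ≠ j ∧ u ≠ 0 ∧ contract i j u f = 0 ∧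
    (j ≠ partner i ∨ ∃ p q : Fin 2 → ℂ, u = fun s t => p s * q t)

/-- `f` is a product for a bipartition of the four qubits. -/
def IsBiseparable (f : (Fin 4 → Fin 2) → ℂ) : Prop :=
  (∃ (i : Fin 4) (a : Fin 2 → ℂ) (h : (Fin 4 → Fin 2) → ℂ),
    DependsOn h ({i}ᶜ : Set (Fin 4)) ∧ f = fun x => a (x i) * h x) ∨
  ∃ (i j : Fin 4) (g : Fin 2 → Fin 2 → ℂ) (h : (Fin 4 → Fin 2) → ℂ), i ≠ j ∧
    DependsOn h ({i, j}ᶜ : Set (Fin 4)) ∧ f = fun x => g (x i) (x j) * h x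

theorem hasVanishingContraction_of_three {f₁ f₂ f₃ : (Fin 4 → Fin 2) → ℂ} {i j : Fin 4}
    (hij : i ≠ j) (hj : j ≠ partner i) {g : Fin 2 → Fin 2 → ℂ} {h : (Fin 4 → Fin 2) → ℂ}
    (hh : DependsOn h ({i, j}ᶜ : Set (Fin 4))) (hf₁ : f₁ = fun x => g (x i) (x j) * h x)
    (hf₂ : IsProd Finset.univ f₂) (hf₃ : IsProd Finset.univ f₃) :
    HasVanishingContraction (f₁ + (f₂ + f₃)) := by
  obtain ⟨g₂, h₂, hh₂, rfl⟩ := hf₂.exists_pair hij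
  obtain ⟨g₃, h₃, hh₃, rfl⟩ := hf₃.exists_pair hij
  obtain ⟨u, hu, hk⟩ := exists_ne_zero_three ![g, g₂, g₃]
  refine ⟨i, j, u, hij, hu, ?_, Or.inl hj⟩
  ext x
  have k₁ := hk 0
  have k₂ := hk 1
  have k₃ := hk 2
  simp only [Matrix.cons_val] at k₁ k₂ k₃
  rw [hf₁, contract_add, contract_add]
  simp only [Pi.add_apply, contract_mul hij u _ hh, contract_mul hij u _ hh₂,
    contract_mul hij u _ hh₃, k₁, k₂, k₃, zero_mul, add_zero, Pi.zero_apply]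

/-- Take `p` on qubit `i` to kill `a`, which removes the first term; then take `q` to kill the
one-qubit vector that `p` leaves of `g`. -/
theorem hasVanishingContraction_single_add_pair {i j : Fin 4} (hij : i ≠ j) {a : Fin 2 → ℂ}
    {g : Fin 2 → Fin 2 → ℂ} {h k : (Fin 4 → Fin 2) → ℂ} (hh : DependsOn h ({i}ᶜ : Set (Fin 4)))
    (hk : DependsOn k ({i, j}ᶜ : Set (Fin 4))) :
    HasVanishingContraction ((fun x => a (x i) * h x) + fun x => g (x i) (x j) * k x) := by
  obtain ⟨p, hp, hpa⟩ := exists_ne_zero_sum_eq_zero a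
  obtain ⟨q, hq, hqg⟩ := exists_ne_zero_sum_eq_zero fun t => ∑ s, p s * g s t
  refine ⟨i, j, _, hij, prod_ne_zero hp hq, ?_, Or.inr ⟨p, q, rfl⟩⟩
  rw [contract_add, contract_eq_zero_left hij hpa q hh, zero_add]
  ext x
  have e : ∑ s, ∑ t, p s * q t * g s t = 0 := by
    rw [Finset.sum_comm, ← hqg]
    simp only [Finset.mul_sum]
    exact Finset.sum_congr rfl fun t _ => Finset.sum_congr rfl fun s _ => by ring
  rw [contract_mul hij _ g hk, e, zero_mul, Pi.zero_apply]

theorem hasVanishingContraction_single_add_single {i j : Fin 4} (hij : i ≠ j) {a b : Fin 2 → ℂ}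
    {h k : (Fin 4 → Fin 2) → ℂ} (hh : DependsOn h ({i}ᶜ : Set (Fin 4)))
    (hk : DependsOn k ({j}ᶜ : Set (Fin 4))) :
    HasVanishingContraction ((fun x => a (x i) * h x) + fun x => b (x j) * k x) := by
  obtain ⟨p, hp, hpa⟩ := exists_ne_zero_sum_eq_zero a
  obtain ⟨q, hq, hqb⟩ := exists_ne_zero_sum_eq_zero b
  refine ⟨i, j, _, hij, prod_ne_zero hp hq, ?_, Or.inr ⟨p, q, rfl⟩⟩
  rw [contract_add, contract_eq_zero_left hij hpa q hh, contract_eq_zero_right hij hqb p hk,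
    zero_add]

theorem IsProd.hasVanishingContraction_add_isBiseparable {f g : (Fin 4 → Fin 2) → ℂ}
    (hf : IsProd Finset.univ f) (hg : IsBiseparable g) : HasVanishingContraction (f + g) := by
  rcases hg with ⟨i, a, h, hh, rfl⟩ | ⟨i, j, g, h, hij, hh, rfl⟩
  · obtain ⟨b, k, hk, rfl⟩ := hf.exists_single (partner i)
    exact hasVanishingContraction_single_add_single (ne_partner i).symm hk hh
  · obtain ⟨b, k, hk, rfl⟩ := hf.exists_single i
    exact hasVanishingContraction_single_add_pair hij hk hh

theorem hasVanishingContraction_add_of_isProdAddProd {f : (Fin 4 → Fin 2) → ℂ} {i j m : Fin 4}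
    (hij : i ≠ j) {a b c : Fin 2 → ℂ} {h k : (Fin 4 → Fin 2) → ℂ}
    (hh : DependsOn h ({i, j}ᶜ : Set (Fin 4))) (hk : DependsOn k ({m}ᶜ : Set (Fin 4)))
    (hf : f = fun x => c (x m) * k x) (hf' : IsProdAddProd Finset.univ f) :
    HasVanishingContraction ((fun x => a (x i) * b (x j) * h x) + f) := by
  by_cases hj : j = partner i
  · subst hj
    rw [add_comm, hf]
    -- The pair is {0, 1} or {2, 3}, so `u` must be a product. If `m` lies in it, one factor kills
    -- `c` on `m` and the other kills the vector on the partner of `m`; otherwise use the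
    -- complementary pair, where `h` is an arbitrary two-qubit vector.
    by_cases hmi : m = i
    · subst hmi
      have e : (fun x => a (x m) * b (x (partner m)) * h x) =
          fun x => b (x (partner m)) * (a (x m) * h x) := by
        ext x
        ring
      rw [e]
      refine hasVanishingContraction_single_add_single hij hk fun x y hxy => ?_
      rw [hxy m (by simpa using hij), hh fun l hl => hxy l (by simp_all)]
    by_cases hmj : m = partner i
    · subst hmj
      have e : (fun x => a (x i) * b (x (partner i)) * h x) =
          fun x => a (x i) * (b (x (partner i)) * h x) := by
        ext x
        ring
      rw [e]
      refine hasVanishingContraction_single_add_single hij.symm hk fun x y hxy => ?_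
      rw [hxy (partner i) (by simpa using hij.symm), hh fun l hl => hxy l (by simp_all)]
    · have hh' : DependsOn h (({m, partner m} : Finset (Fin 4)) : Set (Fin 4)) := by
        refine hh.mono fun l hl => ?_
        simpa using (pair_compl hmi hmj l).mpr (by simpa using hl)
      obtain ⟨g, rfl⟩ := exists_of_dependsOn_pair (ne_partner m) hh'
      have e : (fun x : Fin 4 → Fin 2 => a (x i) * b (x (partner i)) * g (x m) (x (partner m))) =
          fun x => g (x m) (x (partner m)) * (a (x i) * b (x (partner i))) := by
        ext x
        ring
      rw [e]
      refine hasVanishingContraction_single_add_pair (ne_partner m) hk fun x y hxy => ?_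
      rw [hxy i fun hi => (pair_compl hmi hmj i).mp hi (Or.inl rfl),
        hxy (partner i) fun hi => (pair_compl hmi hmj _).mp hi (Or.inr rfl)]
  · obtain ⟨p, q, hp, hq, rfl⟩ := hf'
    exact hasVanishingContraction_of_three hij hj (g := fun s t => a s * b t) hh rfl hp hq

/-! ### Four-qubit trees with at most 13 leaves -/

section Classification

variable {m : ℕ} {S : Finset (Fin 4)} {f : (Fin 4 → Fin 2) → ℂ}

theorem compl_eq_of_union_eq_univ {A B : Finset (Fin 4)} (hd : Disjoint A B)
    (hU : A ∪ B = Finset.univ) : B = Aᶜ := by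
  ext x
  have h₁ := Finset.ext_iff.mp hU x
  have h₂ : x ∈ A → x ∉ B := fun h => Finset.disjoint_left.mp hd h
  simp at h₁ ⊢
  tauto

theorem TreeRep.isBiseparable_mul {k l : ℕ} {A B : Finset (Fin 4)} {g : (Fin 4 → Fin 2) → ℂ}
    (hd : Disjoint A B) (hU : A ∪ B = Finset.univ) (h₁ : TreeRep k A f) (h₂ : TreeRep l B g) :
    IsBiseparable (f * g) := by
  have key : ∀ (A B : Finset (Fin 4)) (f g : (Fin 4 → Fin 2) → ℂ), Disjoint A B →
      A ∪ B = Finset.univ → DependsOn f (A : Set (Fin 4)) → DependsOn g (B : Set (Fin 4)) →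
      A.card = 1 ∨ A.card = 2 → IsBiseparable (f * g) := by
    intro A B f g hd hU hf hg hA
    rw [compl_eq_of_union_eq_univ hd hU, Finset.coe_compl] at hg
    rcases hA with hA | hA
    · obtain ⟨i, rfl⟩ := Finset.card_eq_one.mp hA
      obtain ⟨a, rfl⟩ := exists_of_dependsOn_singleton hf
      exact Or.inl ⟨i, a, g, by simpa using hg, rfl⟩
    · obtain ⟨i, j, hij, rfl⟩ := Finset.card_eq_two.mp hA
      obtain ⟨a, rfl⟩ := exists_of_dependsOn_pair hij hf
      exact Or.inr ⟨i, j, a, g, hij, by simpa using hg, rfl⟩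
  have hc := congrArg Finset.card hU
  rw [Finset.card_union_of_disjoint hd, Finset.card_univ, Fintype.card_fin] at hc
  have c₁ := Finset.card_pos.mpr h₁.nonempty
  have c₂ := Finset.card_pos.mpr h₂.nonempty
  by_cases hA : A.card = 1 ∨ A.card = 2
  · exact key A B f g hd hU h₁.dependsOn h₂.dependsOn hA
  · rw [mul_comm]
    exact key B A g f hd.symm (by rwa [Finset.union_comm]) h₂.dependsOn h₁.dependsOn (by omega)

/-- A root `+` would need 8 leaves. A split 1 + 3 leaves at most 5 leaves for three qubits, which
split off another one; in a split 2 + 2 one side has at most 3 leaves and is a product. -/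
theorem TreeRep.exists_pair_of_le_six (h : TreeRep m S f) (hS : S = Finset.univ) (hm : m ≤ 6) :
    ∃ (i j : Fin 4) (a b : Fin 2 → ℂ) (g : (Fin 4 → Fin 2) → ℂ), i ≠ j ∧
      DependsOn g ({i, j}ᶜ : Set (Fin 4)) ∧ f = fun x => a (x i) * b (x j) * g x := by
  have key : ∀ (k l : ℕ) (A B : Finset (Fin 4)) (f g : (Fin 4 → Fin 2) → ℂ), Disjoint A B →
      A ∪ B = Finset.univ → TreeRep k A f → TreeRep l B g → k + l ≤ 6 →
      (A.card = 1 ∧ B.card = 3) ∨ (A.card = 2 ∧ B.card = 2 ∧ k ≤ 3) →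
      ∃ (i j : Fin 4) (a b : Fin 2 → ℂ) (h : (Fin 4 → Fin 2) → ℂ), i ≠ j ∧
      DependsOn h ({i, j}ᶜ : Set (Fin 4)) ∧ f * g = fun x => a (x i) * b (x j) * h x := by
    intro k l A B f g hd hU h₁ h₂ hkl hc
    have hB := compl_eq_of_union_eq_univ hd hU
    have c₁ := h₁.card_le
    rcases hc with ⟨hA, hc⟩ | ⟨hA, hc, hk⟩
    · obtain ⟨i, rfl⟩ := Finset.card_eq_one.mp hA
      obtain ⟨a, rfl⟩ := exists_of_dependsOn_singleton h₁.dependsOn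
      obtain ⟨j, hj, b, h, hh, rfl⟩ := h₂.exists_eq_mul hc (by omega)
      refine ⟨i, j, a, b, h, ?_, hh.mono ?_, ?_⟩
      · rintro rfl
        simp [hB] at hj
      · intro x hx
        simp_all
      · ext x
        simp [mul_assoc]
    · obtain ⟨i, j, hij, rfl⟩ := Finset.card_eq_two.mp hA
      obtain ⟨v, rfl⟩ := h₁.isProd (by omega)
      refine ⟨i, j, v i, v j, g, hij, h₂.dependsOn.mono ?_, ?_⟩
      · intro x hx
        simp_all
      · ext x
        simp [Finset.prod_pair hij]
  cases h with
  | leaf i v => exact absurd (congrArg Finset.card hS) (by simp)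
  | add h₁ h₂ =>
    have c₁ := h₁.card_le
    have c₂ := h₂.card_le
    rw [hS] at c₁ c₂
    simp at c₁ c₂
    omega
  | @mul k l A B f g hd h₁ h₂ =>
    have hc := congrArg Finset.card hS
    rw [Finset.card_union_of_disjoint hd, Finset.card_univ, Fintype.card_fin] at hc
    have c₁ := Finset.card_pos.mpr h₁.nonempty
    have c₂ := Finset.card_pos.mpr h₂.nonempty
    -- The other cases are mirror images: in a split 2 + 2, `k` and `l` cannot both exceed 3.
    by_cases hA : (A.card = 1 ∧ B.card = 3) ∨ (A.card = 2 ∧ B.card = 2 ∧ k ≤ 3)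
    · exact key k l A B f g hd hS h₁ h₂ hm hA
    · rw [mul_comm]
      exact key l k B A g f hd.symm (by rwa [Finset.union_comm]) h₂ h₁ (by omega) (by omega)

theorem TreeRep.exists_single_of_le_seven (h : TreeRep m S f) (hS : S = Finset.univ)
    (hm : m ≤ 7) :
    IsProdAddProd Finset.univ f ∧ ∃ (i : Fin 4) (a : Fin 2 → ℂ) (g : (Fin 4 → Fin 2) → ℂ),
      DependsOn g ({i}ᶜ : Set (Fin 4)) ∧ f = fun x => a (x i) * g x := by
  have key : ∀ (k l : ℕ) (A B : Finset (Fin 4)) (f g : (Fin 4 → Fin 2) → ℂ), Disjoint A B →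
      A ∪ B = Finset.univ → TreeRep k A f → TreeRep l B g → k + l ≤ 7 →
      (A.card = 1 ∧ B.card = 3) ∨ (A.card = 2 ∧ B.card = 2 ∧ k ≤ 3) →
      IsProdAddProd Finset.univ (f * g) ∧
      ∃ (i : Fin 4) (a : Fin 2 → ℂ) (h : (Fin 4 → Fin 2) → ℂ),
        DependsOn h ({i}ᶜ : Set (Fin 4)) ∧ f * g = fun x => a (x i) * h x := by
    intro k l A B f g hd hU h₁ h₂ hkl hc
    have hB := compl_eq_of_union_eq_univ hd hU
    have c₁ := h₁.card_le
    rcases hc with ⟨hA, hc⟩ | ⟨hA, hc, hk⟩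
    · refine ⟨?_, ?_⟩
      · rw [← hU]
        exact (h₁.isProd_of_card_eq_one hA).mul_isProdAddProd hd
          (h₂.isProdAddProd hc (by omega))
      · obtain ⟨i, rfl⟩ := Finset.card_eq_one.mp hA
        obtain ⟨a, rfl⟩ := exists_of_dependsOn_singleton h₁.dependsOn
        refine ⟨i, a, g, h₂.dependsOn.mono ?_, rfl⟩
        intro x hx
        simp_all
    · refine ⟨?_, ?_⟩
      · rw [← hU]
        exact (h₁.isProd (by omega)).mul_isProdAddProd hd
          (isProdAddProd_of_card_eq_two hc h₂.dependsOn)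
      · obtain ⟨i, j, hij, rfl⟩ := Finset.card_eq_two.mp hA
        obtain ⟨v, rfl⟩ := h₁.isProd (by omega)
        refine ⟨i, v i, fun x => v j (x j) * g x, ?_, ?_⟩
        · intro x y hxy
          simp only
          rw [hxy j (by simpa using hij.symm), h₂.dependsOn fun l hl => hxy l (by simp_all)]
        · ext x
          simp [Finset.prod_pair hij, mul_assoc]
  cases h with
  | leaf i v => exact absurd (congrArg Finset.card hS) (by simp)
  | add h₁ h₂ =>
    have c₁ := h₁.card_le
    have c₂ := h₂.card_le
    rw [hS] at c₁ c₂
    simp at c₁ c₂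
    omega
  | @mul k l A B f g hd h₁ h₂ =>
    have hc := congrArg Finset.card hS
    rw [Finset.card_union_of_disjoint hd, Finset.card_univ, Fintype.card_fin] at hc
    have c₁ := Finset.card_pos.mpr h₁.nonempty
    have c₂ := Finset.card_pos.mpr h₂.nonempty
    by_cases hA : (A.card = 1 ∧ B.card = 3) ∨ (A.card = 2 ∧ B.card = 2 ∧ k ≤ 3)
    · exact key k l A B f g hd hS h₁ h₂ hm hA
    · rw [mul_comm]
      exact key l k B A g f hd.symm (by rwa [Finset.union_comm]) h₂ h₁ (by omega) (by omega)

/-- At a root `+` each summand uses at least 4 of the 9 leaves, hence at most 5, and is a product.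
-/
theorem TreeRep.of_le_nine (h : TreeRep m S f) (hS : S = Finset.univ) (hm : m ≤ 9) :
    IsBiseparable f ∨ IsProdAddProd Finset.univ f := by
  cases h with
  | leaf i v => exact absurd (congrArg Finset.card hS) (by simp)
  | add h₁ h₂ =>
    subst hS
    have c₁ := h₁.card_le
    have c₂ := h₂.card_le
    simp at c₁ c₂
    exact Or.inr ⟨_, _, h₁.isProd (by simp; omega), h₂.isProd (by simp; omega), rfl⟩
  | mul hd h₁ h₂ => exact Or.inl (h₁.isBiseparable_mul hd hS h₂)

theorem TreeRep.hasVanishingContraction_add_of_le_five {k l : ℕ} {g : (Fin 4 → Fin 2) → ℂ}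
    (h₁ : TreeRep k Finset.univ f) (h₂ : TreeRep l Finset.univ g) (hk : k ≤ 5) (hl : l ≤ 9) :
    HasVanishingContraction (f + g) := by
  have hf := h₁.isProd (by simpa using hk)
  rcases h₂.of_le_nine rfl hl with hg | ⟨p, q, hp, hq, rfl⟩
  · exact hf.hasVanishingContraction_add_isBiseparable hg
  -- Any pair other than {0, 1} and {2, 3} serves for three products.
  · obtain ⟨a, h, hh, e⟩ := hf.exists_pair (by decide : (0 : Fin 4) ≠ 2)
    exact hasVanishingContraction_of_three (by decide) (by decide) hh e hp hq

theorem TreeRep.hasVanishingContraction_add_of_le_six {k l : ℕ} {g : (Fin 4 → Fin 2) → ℂ}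
    (h₁ : TreeRep k Finset.univ f) (h₂ : TreeRep l Finset.univ g) (hk : k ≤ 6) (hl : l ≤ 7) :
    HasVanishingContraction (f + g) := by
  obtain ⟨i, j, a, b, p, hij, hp, rfl⟩ := h₁.exists_pair_of_le_six rfl hk
  obtain ⟨hg, m, c, q, hq, e⟩ := h₂.exists_single_of_le_seven rfl hl
  exact hasVanishingContraction_add_of_isProdAddProd hij hp hq e hg

theorem TreeRep.hasVanishingContraction (h : TreeRep m S f) (hS : S = Finset.univ)
    (hm : m ≤ 13) : HasVanishingContraction f := by
  cases h with
  | leaf i v => exact absurd (congrArg Finset.card hS) (by simp)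
  | @add k l S f g h₁ h₂ =>
    subst hS
    have c₁ := h₁.card_le
    have c₂ := h₂.card_le
    simp at c₁ c₂
    by_cases hk : k ≤ 5
    · exact h₁.hasVanishingContraction_add_of_le_five h₂ hk (by omega)
    by_cases hl : l ≤ 5
    · rw [add_comm]
      exact h₂.hasVanishingContraction_add_of_le_five h₁ hl (by omega)
    by_cases hk' : k ≤ 6
    · exact h₁.hasVanishingContraction_add_of_le_six h₂ hk' (by omega)
    · rw [add_comm]
      exact h₂.hasVanishingContraction_add_of_le_six h₁ (by omega) (by omega)
  | mul hd h₁ h₂ =>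
    -- A root `⊗` is treated as a sum with the zero product.
    have h0 : IsProd Finset.univ (0 : (Fin 4 → Fin 2) → ℂ) := ⟨0, by ext x; simp⟩
    simpa using h0.hasVanishingContraction_add_isBiseparable (h₁.isBiseparable_mul hd hS h₂)

end Classification

/-! ### Contractions of the target state -/

/-- `√3` times the amplitudes of `Psi4`. -/
noncomputable def psiAmp (x : Fin 4 → Fin 2) : ℂ :=
  if x 0 = x 1 then (if x 2 = x 3 ∧ x 0 ≠ x 2 then -1 else 0) else if x 2 = x 3 then 0 else 1 / 2

theorem sum_bits {M : Type*} [AddCommMonoid M] (F : (Fin 4 → Fin 2) → M) :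
    ∑ x, F x = ∑ a, ∑ b, ∑ c, ∑ d, F ![a, b, c, d] := by
  let e : Fin 2 × Fin 2 × Fin 2 × Fin 2 ≃ (Fin 4 → Fin 2) :=
    { toFun := fun p => ![p.1, p.2.1, p.2.2.1, p.2.2.2]
      invFun := fun x => (x 0, x 1, x 2, x 3)
      left_inv := fun p => rfl
      right_inv := fun x => by
        ext k
        fin_cases k <;> rfl }
  rw [← e.sum_comp F]
  simp only [Fintype.sum_prod_type]
  rfl

theorem forall_bits {p : (Fin 4 → Fin 2) → Prop} (h : ∀ a b c d, p ![a, b, c, d]) (x) : p x := by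
  have e : x = ![x 0, x 1, x 2, x 3] := by
    ext k
    fin_cases k <;> rfl
  rw [e]
  exact h _ _ _ _

theorem Psi4_apply (x : Fin 4 → Fin 2) : Psi4 x = ((Real.sqrt (1 / 3) : ℝ) : ℂ) * psiAmp x := by
  revert x
  apply forall_bits
  intro a b c d
  fin_cases a <;> fin_cases b <;> fin_cases c <;> fin_cases d <;>
    simp [Psi4, ket, psiAmp]

theorem sum_update {n : ℕ} (F : (Fin n → Fin 2) → ℂ) (i : Fin n) :
    ∑ x, ∑ s, F (Function.update x i s) = 2 * ∑ x, F x := by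
  have h1 : ∀ x : Fin n → Fin 2, ∑ s, F (Function.update x i s) =
      F x + F (Function.update x i (x i + 1)) := by
    intro x
    have hs : ∀ s : Fin 2, ∑ t, F (Function.update x i t) =
        F (Function.update x i s) + F (Function.update x i (s + 1)) := by
      intro s
      rw [Fin.sum_univ_two]
      fin_cases s
      · rfl
      · exact add_comm _ _
    rw [hs (x i), Function.update_eq_self]
  have h2 : ∑ x, F (Function.update x i (x i + 1)) = ∑ x, F x := by
    have hinv : Function.Involutive fun x : Fin n → Fin 2 => Function.update x i (x i + 1) := by
      intro x
      have : ∀ s : Fin 2, s + 1 + 1 = s := by decide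
      simp [this]
    exact Equiv.sum_comp hinv.toPerm F
  simp only [h1, Finset.sum_add_distrib, h2, two_mul]

theorem sum_update_update {n : ℕ} (F : (Fin n → Fin 2) → ℂ) (i j : Fin n) :
    ∑ x, ∑ s, ∑ t, F (Function.update (Function.update x i s) j t) = 4 * ∑ x, F x := by
  rw [sum_update (fun x => ∑ t, F (Function.update x j t)), sum_update, ← mul_assoc]
  norm_num

/-- The matrix with diagonal entries -1 and off-diagonal entries 1/2 has eigenvalues -1/2 and -3/2.
-/
theorem normSq_sum_le_cross (a b : ℂ) :
    Complex.normSq a + Complex.normSq b ≤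
      4 * (Complex.normSq (-a + b * 2⁻¹) + Complex.normSq (a * 2⁻¹ + -b)) := by
  simp only [← div_eq_mul_inv, Complex.normSq_apply, Complex.add_re, Complex.add_im,
    Complex.neg_re, Complex.neg_im, Complex.div_ofNat_re, Complex.div_ofNat_im]
  nlinarith [sq_nonneg (a.re - b.re), sq_nonneg (a.im - b.im)]

/-- The sum `b + c` can cancel, but `‖b‖ * ‖c‖ = ‖a‖ * ‖d‖` bounds the loss by the terms in `a` and
`d`. -/
theorem normSq_sum_le_pair {a b c d : ℂ} (h : a * d = b * c) :
    Complex.normSq a + Complex.normSq b + Complex.normSq c + Complex.normSq d ≤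
      4 * (Complex.normSq a + Complex.normSq d) + 8 * Complex.normSq (b * 2⁻¹ + c * 2⁻¹) := by
  have h₁ : ‖a‖ * ‖d‖ = ‖b‖ * ‖c‖ := by rw [← norm_mul, h, norm_mul]
  have h₂ : -(‖b‖ * ‖c‖) ≤ (b * (starRingEnd ℂ) c).re := by
    have := Complex.abs_re_le_norm (b * (starRingEnd ℂ) c)
    rw [norm_mul, RCLike.norm_conj] at this
    exact (abs_le.mp this).1
  have h₃ : Complex.normSq (2⁻¹ : ℂ) = 1 / 4 := by
    rw [map_inv₀, Complex.normSq_ofNat]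
    norm_num
  rw [← add_mul, Complex.normSq_mul, h₃, Complex.normSq_add]
  simp only [Complex.normSq_eq_norm_sq]
  nlinarith [sq_nonneg (‖a‖ - ‖d‖), sq_nonneg (‖b‖ - ‖c‖)]

/-- The sum over all `x` counts each assignment of the two remaining bits four times, so the
constant 1 encodes the squared singular value 1/4. -/
theorem sum_normSq_contract_psiAmp {i j : Fin 4} (hij : i ≠ j) {u : Fin 2 → Fin 2 → ℂ}
    (h : j ≠ partner i ∨ ∃ p q : Fin 2 → ℂ, u = fun s t => p s * q t) :
    ∑ s, ∑ t, Complex.normSq (u s t) ≤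
      ∑ x, Complex.normSq (contract i j u psiAmp x) := by
  have h0 := Complex.normSq_nonneg (u 0 0)
  have h1 := Complex.normSq_nonneg (u 1 1)
  rw [sum_bits]
  by_cases hj : j = partner i
  · obtain ⟨p, q, rfl⟩ := h.resolve_left (not_not.mpr hj)
    have key := normSq_sum_le_pair
      (by ring : p 0 * q 0 * (p 1 * q 1) = p 0 * q 1 * (p 1 * q 0))
    simp only [Complex.normSq_mul] at key
    subst hj
    fin_cases i <;> simp [contract, psiAmp, Fin.sum_univ_two, partner]
    all_goals linarith
  · have key := normSq_sum_le_cross (u 0 1) (u 1 0)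
    fin_cases i <;> fin_cases j <;> simp [partner] at hij hj <;>
      simp [contract, psiAmp, Fin.sum_univ_two] 
    all_goals linarith

theorem contract_update_update {n : ℕ} {i j : Fin n} (u : Fin 2 → Fin 2 → ℂ)
    (f : (Fin n → Fin 2) → ℂ) (x : Fin n → Fin 2) (s t : Fin 2) :
    contract i j u f (Function.update (Function.update x i s) j t) = contract i j u f x := by
  refine Finset.sum_congr rfl fun s' _ => Finset.sum_congr rfl fun t' _ => ?_
  congr 2
  ext k
  by_cases hj : k = j
  · subst hj
    simp
  · by_cases hi : k = i
    · subst hi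
      simp [hj]
    · simp [hi, hj]

/-! ### From a vanishing contraction to the overlap bound -/

theorem norm_Psi4 : ‖Psi4‖ = 1 := by
  have h : ‖Psi4‖ ^ 2 = 1 := by
    rw [EuclideanSpace.norm_sq_eq, sum_bits]
    simp only [Psi4_apply, norm_mul, mul_pow, ← Complex.normSq_eq_norm_sq, Fin.sum_univ_two]
    simp [psiAmp]
    norm_num
  nlinarith [norm_nonneg Psi4]

theorem norm_inner_sq_le {φ : QubitSpace 4} (hφ : ‖φ‖ = 1)
    (h : HasVanishingContraction fun x => φ x) : ‖inner ℂ Psi4 φ‖ ^ 2 ≤ 11 / 12 := by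
  obtain ⟨i, j, u, hij, hu, hc, hp⟩ := h
  have hN := sum_normSq_contract_psiAmp hij hp
  set g := contract i j u psiAmp with hg
  -- `z` is the adjoint of the contraction applied to `g`: it is orthogonal to the kernel of the
  -- contraction, hence to `φ`. The conjugate appears because `contract` is bilinear.
  let z : QubitSpace 4 := WithLp.toLp 2 fun x => (starRingEnd ℂ) (u (x i) (x j)) * g x
  have hpair : ∀ f : (Fin 4 → Fin 2) → ℂ,
      4 * ∑ x, f x * (starRingEnd ℂ) (z x) =
        ∑ x, contract i j u f x * (starRingEnd ℂ) (g x) := by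
    intro f
    rw [← sum_update_update _ i j]
    refine Finset.sum_congr rfl fun x _ => ?_
    rw [contract, Finset.sum_mul]
    refine Finset.sum_congr rfl fun s _ => ?_
    rw [Finset.sum_mul]
    refine Finset.sum_congr rfl fun t _ => ?_
    simp only [z, hg, contract_update_update, map_mul, Complex.conj_conj]
    rw [Function.update_self, Function.update_of_ne hij, Function.update_self]
    ring
  have hzφ : inner ℂ z φ = 0 := by
    have := hpair fun x => φ x
    rw [hc] at this
    simpa [PiLp.inner_apply] using this
  set N : ℝ := ∑ x, Complex.normSq (g x) with hNdef
  set U : ℝ := ∑ s, ∑ t, Complex.normSq (u s t) with hUdef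
  have hzΨ : inner ℂ z Psi4 = ((Real.sqrt (1 / 3) * (N / 4) : ℝ) : ℂ) := by
    have := hpair psiAmp
    simp only [← hg, Complex.mul_conj] at this
    simp only [PiLp.inner_apply, RCLike.inner_apply, Psi4_apply, mul_assoc, ← Finset.mul_sum]
    rw [← Complex.ofReal_sum, ← hNdef] at this
    push_cast
    linear_combination ((Real.sqrt (1 / 3) : ℝ) : ℂ) / 4 * this
  have hz : ‖z‖ ^ 2 = U * N / 4 := by
    have hc' : ∀ x, contract i j u (fun x => z x) x = U * g x := by
      intro x
      simp only [hUdef, Complex.ofReal_sum, Finset.sum_mul]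
      refine Finset.sum_congr rfl fun s _ => Finset.sum_congr rfl fun t _ => ?_
      simp only [z, hg, contract_update_update]
      rw [Function.update_self, Function.update_of_ne hij, Function.update_self,
        ← Complex.mul_conj]
      ring
    have := hpair fun x => z x
    simp only [hc', mul_assoc, Complex.mul_conj, ← Finset.mul_sum] at this
    rw [EuclideanSpace.norm_sq_eq]
    simp only [← Complex.normSq_eq_norm_sq]
    have h' : 4 * ∑ x, Complex.normSq (z x) = U * N := by exact_mod_cast this
    linarith
  have hU : 0 < U := by
    obtain ⟨s, hs⟩ := Function.ne_iff.mp hu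
    obtain ⟨t, ht⟩ := Function.ne_iff.mp hs
    refine Finset.sum_pos' (fun _ _ => Finset.sum_nonneg fun _ _ => Complex.normSq_nonneg _)
      ⟨s, Finset.mem_univ _, Finset.sum_pos' (fun _ _ => Complex.normSq_nonneg _)
        ⟨t, Finset.mem_univ _, Complex.normSq_pos.mpr ht⟩⟩
  -- `r` is the component of `Psi4` orthogonal to `φ`. Since `z` has the same inner product with `r`
  -- as with `Psi4`, Cauchy–Schwarz bounds `‖r‖` from below.
  set r : QubitSpace 4 := Psi4 - (inner ℂ φ Psi4) • φ with hr
  have hzr : inner ℂ z r = inner ℂ z Psi4 := by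
    rw [hr, inner_sub_right, inner_smul_right, hzφ, mul_zero, sub_zero]
  have hrn : ‖r‖ ^ 2 = 1 - ‖inner ℂ Psi4 φ‖ ^ 2 := by
    rw [hr, norm_sub_sq (𝕜 := ℂ), inner_smul_right, norm_smul, hφ, norm_Psi4,
      ← inner_conj_symm φ Psi4, RCLike.conj_mul, RCLike.norm_conj]
    norm_cast
    ring
  have hcs := norm_inner_le_norm (𝕜 := ℂ) z r
  rw [hzr, hzΨ, Complex.norm_real, Real.norm_eq_abs] at hcs
  have hcs2 : (Real.sqrt (1 / 3) * (N / 4)) ^ 2 ≤ ‖z‖ ^ 2 * ‖r‖ ^ 2 := by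
    rw [← sq_abs, ← mul_pow]
    gcongr
  rw [mul_pow, Real.sq_sqrt (by norm_num), hz, hrn] at hcs2
  -- Cauchy–Schwarz reads N² / 48 ≤ (U N / 4) ‖r‖²; insert `U ≤ N`, then cancel the positive `N` and
  -- `U`.
  have hNU : N * (U * (1 / 12)) ≤ N * (U * (1 - ‖inner ℂ Psi4 φ‖ ^ 2)) := by nlinarith
  have := le_of_mul_le_mul_left (le_of_mul_le_mul_left hNU (by linarith)) hU
  linarith

/-! ### Approximation with 14 leaves -/

theorem TreeRep.ofReal_mul_sub (e a b c a' b' c' : Fin 2 → ℝ) (r : ℝ) :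
    TreeRep 7 (Finset.univ : Finset (Fin 4)) fun x => ((e (x 0) *
      (r * (a (x 1) * (b (x 2) * c (x 3))) - r * (a' (x 1) * (b' (x 2) * c' (x 3)))) : ℝ) : ℂ) := by
  have h3 : ∀ a b c : Fin 2 → ℝ, TreeRep 3 ({1} ∪ ({2} ∪ {3}) : Finset (Fin 4)) _ := fun a b c =>
    (leaf 1 fun s => (a s : ℂ)).mul (by decide)
      ((leaf 2 fun s => (b s : ℂ)).mul (by decide) (leaf 3 fun s => (c s : ℂ)))
  have h := (leaf (0 : Fin 4) fun s => (e s : ℂ)).mul (by decide)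
    (((h3 a b c).smul r).add ((h3 a' b' c').smul (-r)))
  have hU : ({0} ∪ ({1} ∪ ({2} ∪ {3})) : Finset (Fin 4)) = Finset.univ := by decide
  rw [hU] at h
  convert h using 1
  ext x
  simp only [Pi.mul_apply, Pi.add_apply, Pi.smul_apply, smul_eq_mul]
  push_cast
  ring

/-- Amplitudes of an approximation of `√3 • Psi4` with a tree of 14 leaves. The two three-qubit
states in `Psi4` that belong to the bits of the first qubit are limits of sums of two product
states. -/
noncomputable def approxAmp (t : ℝ) (x : Fin 4 → Fin 2) : ℝ :=
  (![1, 0] : Fin 2 → ℝ) (x 0) *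
      (t⁻¹ * (![-t, 1] (x 1) * (![t / 2, 1] (x 2) * ![t / 2, 1] (x 3))) -
        t⁻¹ * (![0, 1] (x 1) * (![0, 1] (x 2) * ![0, 1] (x 3)))) +
    (![0, 1] : Fin 2 → ℝ) (x 0) *
      (t⁻¹ * (![1, -t] (x 1) * (![1, t / 2] (x 2) * ![1, t / 2] (x 3))) -
        t⁻¹ * (![1, 0] (x 1) * (![1, 0] (x 2) * ![1, 0] (x 3))))

theorem treeRep_approxAmp (t : ℝ) : TreeRep 14 Finset.univ fun x => (approxAmp t x : ℂ) := by
  convert (TreeRep.ofReal_mul_sub ![1, 0] ![-t, 1] ![t / 2, 1] ![t / 2, 1] ![0, 1] ![0, 1] ![0, 1]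
    t⁻¹).add (TreeRep.ofReal_mul_sub ![0, 1] ![1, -t] ![1, t / 2] ![1, t / 2] ![1, 0] ![1, 0] ![1, 0]
    t⁻¹) using 1
  ext x
  simp only [Pi.add_apply, approxAmp, Complex.ofReal_add]

theorem sum_approxAmp_sq {t : ℝ} (ht : t ≠ 0) :
    ∑ x, approxAmp t x ^ 2 = 3 + 9 / 8 * t ^ 2 + t ^ 4 / 8 := by
  rw [sum_bits]
  simp [approxAmp, Fin.sum_univ_two]
  field_simp
  ring

theorem sum_approxAmp_mul_psiAmp {t : ℝ} (ht : t ≠ 0) :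
    ∑ x, (approxAmp t x : ℂ) * psiAmp x = 3 := by
  have ht' : (t : ℂ) ≠ 0 := by exact_mod_cast ht
  rw [sum_bits]
  simp [approxAmp, psiAmp, Fin.sum_univ_two]
  field_simp
  ring

theorem conj_psiAmp (x : Fin 4 → Fin 2) : (starRingEnd ℂ) (psiAmp x) = psiAmp x := by
  unfold psiAmp
  split_ifs <;> simp [map_ofNat]

theorem exists_approx {ε : ℝ} (h0 : 0 < ε) (h1 : ε < 1 / 12) :
    ∃ φ : QubitSpace 4, ‖φ‖ = 1 ∧ 1 - ε ≤ ‖inner ℂ Psi4 φ‖ ^ 2 ∧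
      TreeRep 14 Finset.univ fun x => φ x := by
  -- The overlap with `√3 • Psi4` is exactly 3 and the squared norm is 3 + O(t²), so `t = ε` already
  -- loses less than `ε`.
  let φ : QubitSpace 4 := WithLp.toLp 2 fun x => (approxAmp ε x : ℂ)
  have hn : ‖φ‖ ^ 2 = 3 + 9 / 8 * ε ^ 2 + ε ^ 4 / 8 := by
    rw [EuclideanSpace.norm_sq_eq, ← sum_approxAmp_sq h0.ne']
    simp [φ]
  have hpos : 0 < ‖φ‖ := by
    have : 0 < ‖φ‖ ^ 2 := by
      rw [hn]
      positivity
    exact (sq_pos_iff.mp this).lt_of_le' (norm_nonneg _)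
  have hi : inner ℂ Psi4 φ = ((Real.sqrt (1 / 3) * 3 : ℝ) : ℂ) := by
    simp only [PiLp.inner_apply, RCLike.inner_apply, Psi4_apply, map_mul, conj_psiAmp,
      Complex.conj_ofReal, mul_left_comm _ ((Real.sqrt (1 / 3) : ℝ) : ℂ), ← Finset.mul_sum, φ]
    rw [sum_approxAmp_mul_psiAmp h0.ne']
    push_cast
    rfl
  refine ⟨((‖φ‖⁻¹ : ℝ) : ℂ) • φ, ?_, ?_, (treeRep_approxAmp ε).smul _⟩
  · rw [norm_smul, Complex.norm_real, norm_inv, norm_norm, inv_mul_cancel₀ hpos.ne']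
  · rw [inner_smul_right, hi, ← Complex.ofReal_mul, Complex.norm_real, Real.norm_eq_abs, sq_abs,
      mul_pow, mul_pow, Real.sq_sqrt (by norm_num), inv_pow, hn, inv_mul_eq_div,
      le_div_iff₀ (by positivity)]
    have : ε ^ 2 ≤ ε := by nlinarith
    have : ε ^ 4 ≤ ε := by nlinarith [sq_nonneg (ε ^ 2), sq_nonneg ε]
    nlinarith [pow_pos h0 3, pow_pos h0 5]

theorem norm_inner_sq_le_of_size_le {φ : QubitSpace 4}
    {T : StateTree (Finset.univ : Finset (Fin 4))} (hφ : ‖φ‖ = 1) (hT : T.Describes φ)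
    (hs : T.size ≤ 13) : ‖inner ℂ Psi4 φ‖ ^ 2 ≤ 11 / 12 := by
  refine norm_inner_sq_le hφ ?_
  rw [funext hT]
  exact (TreeRep.of_tree T).hasVanishingContraction rfl hs

theorem proposition7 :
    (∀ ε : ℝ, 0 < ε → ε < 1 / 12 → approxTreeSize ε Psi4 = 14) ∧
    (∀ (φ : QubitSpace 4) (T : StateTree (Finset.univ : Finset (Fin 4))),
      ‖φ‖ = 1 → T.Describes φ → T.size ≤ 13 → ‖inner ℂ Psi4 φ‖ ^ 2 ≤ 11 / 12) := by
  refine ⟨fun ε h0 h1 => le_antisymm ?_ ?_, fun φ T => norm_inner_sq_le_of_size_le⟩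
  · obtain ⟨φ, hφ, hε, h⟩ := exists_approx h0 h1
    obtain ⟨T, hT, ha⟩ := h.exists_tree
    refine iInf_le_of_le φ (iInf_le_of_le hφ (iInf_le_of_le hε (iInf_le_of_le T
      (iInf_le_of_le (fun x => (congrFun ha x).symm) ?_))))
    rw [hT]
    rfl
  · refine le_iInf fun φ => le_iInf fun hφ => le_iInf fun hε => le_iInf fun T => le_iInf fun hT => ?_
    by_contra hlt
    have hs : T.size < 14 := by
      rw [not_le] at hlt
      exact_mod_cast hlt
    have := norm_inner_sq_le_of_size_le hφ hT (by omega)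
    linarith
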